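/- Let $\mathbb K\in\{\mathbb R,\mathbb C\}$. For $m,n\in\mathbb N$ let $\mathscr O^m_n(\mathbb R)$ be the Banach space of all $f\in C^m(\mathbb R)$ with values in $\mathbb K$ such that $$|f|_{m,n}:=\sup_{x\in\mathbb R,\,0\le j\le m}(1+|x|^2)^{-n}|f^{(j)}(x)|<\infty ,$$ let $\mathscr O^m(\mathbb R)=\bigcup_n\mathscr O^m_n(\mathbb R)$ carry the topology of the locally convex inductive limit $\operatorname{ind}_{n\to\infty}\mathscr O^m_n(\mathbb R)$, and let $\mathscr O_M(\mathbb R)=\bigcap_m\mathscr O^m(\mathbb R)$ carry the topology of the projective limit of the spaces $\mathscr O^m(\mathbb R)$. A continuous linear operator $T$ on a locally convex space $E$ is called sequentially hypercyclic if there is $g\in E$ such that every $f\in E$ is the limit of a sequence of elements of the orbit $\{T^ng:\,n=0,1,2,\dots\}$. Let $\psi:\mathbb R\to\mathbb R$ be a bijective function in $\mathscr O_M(\mathbb R)$ without fixed points and with $\psi'(x)>0$ for every $x\in\mathbb R$. Let $\psi_0=\mathrm{id}$, and for $n\ge1$ let $\psi_n=\psi\circ\psi_{n-1}$ and $\psi_{-n}=(\psi_n)^{-1}$.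 If $(\psi_n)'$ belongs to $\mathscr O_M(\mathbb R)$ for every $n\in\mathbb Z$ and the set $\{(\psi_n)':\,n\in\mathbb Z\}$ is bounded in $\mathscr O_M(\mathbb R)$, then the composition operator $C_\psi:\mathscr O_M(\mathbb R)\to\mathscr O_M(\mathbb R)$, $f\mapsto f\circ\psi$, is sequentially hypercyclic. -/

import Mathlib

noncomputable section

open Set Filter Topology
open scoped Nat

namespace SlowGrowth

variable (𝕜 : Type*) [RCLike 𝕜]

section Weighted

variable {𝕜}

/-- The quantity `(1 + |x|²)^(-n) |f^(j)(x)|`, indexed by the pairs `(x, j)` with `0 ≤ j ≤ m`. -/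
def weighted (m n : ℕ) (f : ℝ → 𝕜) (p : ℝ × Fin (m + 1)) : ℝ :=
  ((1 + |p.1| ^ 2) ^ n)⁻¹ * ‖iteratedDeriv p.2 f p.1‖

theorem weighted_nonneg (m n : ℕ) (f : ℝ → 𝕜) (p : ℝ × Fin (m + 1)) :
    0 ≤ weighted m n f p := by
  unfold weighted; positivity

theorem weighted_add_le {m n : ℕ} {f g : ℝ → 𝕜} (hf : ContDiff ℝ m f) (hg : ContDiff ℝ m g)
    (p : ℝ × Fin (m + 1)) :
    weighted m n (f + g) p ≤ weighted m n f p + weighted m n g p := by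
  have hj : ((p.2 : ℕ) : WithTop ℕ∞) ≤ (m : WithTop ℕ∞) := by
    exact_mod_cast Nat.lt_succ_iff.mp p.2.2
  unfold weighted
  rw [iteratedDeriv_add (hf.of_le hj).contDiffAt (hg.of_le hj).contDiffAt, ← mul_add]
  gcongr
  exact norm_add_le _ _

theorem weighted_smul (m n : ℕ) (c : 𝕜) (f : ℝ → 𝕜) (p : ℝ × Fin (m + 1)) :
    weighted m n (c • f) p = ‖c‖ * weighted m n f p := by
  unfold weighted
  rw [iteratedDeriv_const_smul_field, norm_smul]
  ring

theorem le_of_weighted_le {m n : ℕ} {f : ℝ → 𝕜} {C : ℝ} (h : ∀ p, weighted m n f p ≤ C)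
    {j : ℕ} (hj : j ≤ m) (x : ℝ) : ‖iteratedDeriv j f x‖ ≤ C * (1 + |x| ^ 2) ^ n := by
  have := h (x, ⟨j, Nat.lt_succ_of_le hj⟩)
  unfold weighted at this
  rwa [inv_mul_le_iff₀ (by positivity), mul_comm] at this

theorem weighted_le_of_le {m n : ℕ} {f : ℝ → 𝕜} {C : ℝ}
    (h : ∀ j ≤ m, ∀ x, ‖iteratedDeriv j f x‖ ≤ C * (1 + |x| ^ 2) ^ n) (p : ℝ × Fin (m + 1)) :
    weighted m n f p ≤ C := by
  unfold weighted
  rw [inv_mul_le_iff₀ (by positivity), mul_comm]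
  exact h _ (Nat.lt_succ_iff.mp p.2.2) _

end Weighted

/-- The functions `f` of class `C^m` with `sup_{x, j ≤ m} (1 + |x|²)^(-n) |f^(j)(x)| < ∞`,
as a vector space of functions. -/
def stepSubmodule (m n : ℕ) : Submodule 𝕜 (ℝ → 𝕜) where
  carrier := {f | ContDiff ℝ m f ∧ BddAbove (range (weighted m n f))}
  zero_mem' := by
    refine ⟨contDiff_const, 0, ?_⟩
    rintro _ ⟨p, rfl⟩
    have := weighted_smul m n (0 : 𝕜) 0 p
    simpa using this.le
  add_mem' := by
    rintro f g ⟨hf, A, hA⟩ ⟨hg, B, hB⟩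
    refine ⟨hf.add hg, A + B, ?_⟩
    rintro _ ⟨p, rfl⟩
    exact (weighted_add_le hf hg p).trans (add_le_add (hA ⟨p, rfl⟩) (hB ⟨p, rfl⟩))
  smul_mem' := by
    rintro c f ⟨hf, A, hA⟩
    refine ⟨hf.const_smul c, ‖c‖ * A, ?_⟩
    rintro _ ⟨p, rfl⟩
    rw [weighted_smul]
    exact mul_le_mul_of_nonneg_left (hA ⟨p, rfl⟩) (norm_nonneg c)

/-- The normed space `𝒪ₙᵐ(ℝ)`. It is a type of its own, so that it does not carry the topology
of pointwise convergence of `ℝ → 𝕜`. -/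
def OStep (m n : ℕ) : Type _ := stepSubmodule 𝕜 m n

instance (m n : ℕ) : AddCommGroup (OStep 𝕜 m n) := inferInstanceAs (AddCommGroup (stepSubmodule 𝕜 m n))
instance (m n : ℕ) : Module 𝕜 (OStep 𝕜 m n) := inferInstanceAs (Module 𝕜 (stepSubmodule 𝕜 m n))

/-- The norm `|f|_{m,n} = sup_{x, j ≤ m} (1 + |x|²)^(-n) |f^(j)(x)|`. -/
instance (m n : ℕ) : Norm (OStep 𝕜 m n) := ⟨fun f ↦ ⨆ p, weighted m n f.1 p⟩

theorem weighted_le_norm {m n : ℕ} (f : OStep 𝕜 m n) (p : ℝ × Fin (m + 1)) :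
    weighted m n f.1 p ≤ ‖f‖ :=
  le_ciSup f.2.2 p

theorem norm_core (m n : ℕ) : NormedSpace.Core 𝕜 (OStep 𝕜 m n) where
  norm_nonneg f := Real.iSup_nonneg fun p ↦ weighted_nonneg m n f.1 p
  norm_smul c f := by
    change (⨆ p, weighted m n (c • f.1) p) = ‖c‖ * ⨆ p, weighted m n f.1 p
    simp_rw [weighted_smul]
    exact (Real.mul_iSup_of_nonneg (norm_nonneg c) _).symm
  norm_triangle f g := ciSup_le fun p ↦ (weighted_add_le f.2.1 g.2.1 p).trans
    (add_le_add (weighted_le_norm 𝕜 f p) (weighted_le_norm 𝕜 g p))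
  norm_eq_zero_iff f := by
    constructor
    · intro h
      refine Subtype.ext (funext fun x ↦ ?_)
      have := le_of_weighted_le (fun p ↦ (weighted_le_norm 𝕜 f p).trans h.le) (Nat.zero_le m) x
      have h0 : f.1 x = 0 := by simpa using this
      exact h0
    · rintro rfl
      have h (p : ℝ × Fin (m + 1)) : weighted m n (0 : ℝ → 𝕜) p = 0 := by
        simpa using weighted_smul m n (0 : 𝕜) 0 p
      change (⨆ p, weighted m n (0 : ℝ → 𝕜) p) = 0
      simp [h]

instance (m n : ℕ) : NormedAddCommGroup (OStep 𝕜 m n) := .ofCore (norm_core 𝕜 m n)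
instance (m n : ℕ) : NormedSpace 𝕜 (OStep 𝕜 m n) := .ofCore (norm_core 𝕜 m n)

theorem stepSubmodule_mono (m : ℕ) {n k : ℕ} (h : n ≤ k) :
    stepSubmodule 𝕜 m n ≤ stepSubmodule 𝕜 m k := by
  rintro f ⟨hf, A, hA⟩
  refine ⟨hf, A, ?_⟩
  rintro _ ⟨p, rfl⟩
  refine le_trans ?_ (hA ⟨p, rfl⟩)
  unfold weighted
  gcongr
  nlinarith [sq_nonneg |p.1|]

/-- The union over `n` of the spaces `𝒪ₙᵐ(ℝ)`. -/
def levelSubmodule (m : ℕ) : Submodule 𝕜 (ℝ → 𝕜) where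
  carrier := {f | ∃ n, f ∈ stepSubmodule 𝕜 m n}
  zero_mem' := ⟨0, zero_mem _⟩
  add_mem' := by
    rintro f g ⟨a, ha⟩ ⟨b, hb⟩
    exact ⟨max a b, add_mem (stepSubmodule_mono 𝕜 m (le_max_left a b) ha)
      (stepSubmodule_mono 𝕜 m (le_max_right a b) hb)⟩
  smul_mem' := by
    rintro c f ⟨a, ha⟩
    exact ⟨a, Submodule.smul_mem _ c ha⟩

/-- The (LB)-space `𝒪ᵐ(ℝ)`, the locally convex inductive limit of the `𝒪ₙᵐ(ℝ)`. -/
def OLevel (m : ℕ) : Type _ := levelSubmodule 𝕜 m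

instance (m : ℕ) : AddCommGroup (OLevel 𝕜 m) := inferInstanceAs (AddCommGroup (levelSubmodule 𝕜 m))
instance (m : ℕ) : Module 𝕜 (OLevel 𝕜 m) := inferInstanceAs (Module 𝕜 (levelSubmodule 𝕜 m))
instance (m : ℕ) : Module ℝ (OLevel 𝕜 m) := inferInstanceAs (Module ℝ (levelSubmodule 𝕜 m))

/-- The inclusion of `𝒪ₙᵐ(ℝ)` in `𝒪ᵐ(ℝ)`. -/
def stepIncl (m n : ℕ) : OStep 𝕜 m n →ₗ[𝕜] OLevel 𝕜 m where
  toFun f := ⟨f.1, n, f.2⟩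
  map_add' _ _ := rfl
  map_smul' _ _ := rfl

/-- The finest locally convex topology on `𝒪ᵐ(ℝ)` for which all the inclusions
`𝒪ₙᵐ(ℝ) → 𝒪ᵐ(ℝ)` are continuous. -/
instance (m : ℕ) : TopologicalSpace (OLevel 𝕜 m) :=
  sInf {t : TopologicalSpace (OLevel 𝕜 m) |
    (∀ n, @Continuous (OStep 𝕜 m n) (OLevel 𝕜 m) _ t (stepIncl 𝕜 m n)) ∧
    @IsTopologicalAddGroup (OLevel 𝕜 m) t _ ∧
    @ContinuousSMul 𝕜 (OLevel 𝕜 m) _ _ t ∧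
    @LocallyConvexSpace ℝ (OLevel 𝕜 m) _ _ _ _ t}

instance (m : ℕ) : IsTopologicalAddGroup (OLevel 𝕜 m) :=
  topologicalAddGroup_sInf fun _ ht ↦ ht.2.1

instance (m : ℕ) : ContinuousSMul 𝕜 (OLevel 𝕜 m) :=
  continuousSMul_sInf fun _ ht ↦ ht.2.2.1

instance (m : ℕ) : LocallyConvexSpace ℝ (OLevel 𝕜 m) :=
  .sInf fun _ ht ↦ ht.2.2.2

theorem continuous_stepIncl (m n : ℕ) : Continuous (stepIncl 𝕜 m n) :=
  continuous_sInf_rng.2 fun _ ht ↦ ht.1 n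

/-- The functions which belong to `𝒪ᵐ(ℝ)` for every `m`, as a vector space of functions. -/
def omSubmodule : Submodule 𝕜 (ℝ → 𝕜) := ⨅ m, levelSubmodule 𝕜 m

/-- The space `𝒪_M(ℝ)` of slowly increasing smooth functions with values in `𝕜`. -/
def OM : Type _ := omSubmodule 𝕜

instance : AddCommGroup (OM 𝕜) := inferInstanceAs (AddCommGroup (omSubmodule 𝕜))
instance : Module 𝕜 (OM 𝕜) := inferInstanceAs (Module 𝕜 (omSubmodule 𝕜))

variable {𝕜} in
/-- A function which belongs to `𝒪_M(ℝ)`, as an element of this space. -/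
def toOM (f : ℝ → 𝕜) (hf : f ∈ omSubmodule 𝕜) : OM 𝕜 := ⟨f, hf⟩

/-- The inclusion of `𝒪_M(ℝ)` in `𝒪ᵐ(ℝ)`. -/
def levelIncl (m : ℕ) : OM 𝕜 →ₗ[𝕜] OLevel 𝕜 m where
  toFun f := ⟨f.1, (Submodule.mem_iInf _).1 f.2 m⟩
  map_add' _ _ := rfl
  map_smul' _ _ := rfl

/-- The projective limit topology on `𝒪_M(ℝ)`: the coarsest topology for which all the inclusions
`𝒪_M(ℝ) → 𝒪ᵐ(ℝ)` are continuous. -/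
instance : TopologicalSpace (OM 𝕜) := ⨅ m, TopologicalSpace.induced (levelIncl 𝕜 m) inferInstance

theorem continuous_levelIncl (m : ℕ) : Continuous (levelIncl 𝕜 m) :=
  continuous_iInf_dom (i := m) continuous_induced_dom

section Composition

variable {ψ : ℝ → ℝ}

/-- Composition with `ψ ∈ 𝒪_M(ℝ)` maps `𝒪ₙᵐ(ℝ)` to some `𝒪ₖᵐ(ℝ)`, with a norm estimate. -/
theorem exists_comp_bound (hψ : ψ ∈ omSubmodule ℝ) (m n : ℕ) :
    ∃ (k : ℕ) (A : ℝ), ∀ f : OStep 𝕜 m n,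
      ContDiff ℝ m (f.1 ∘ ψ) ∧ ∀ p, weighted m k (f.1 ∘ ψ) p ≤ A * ‖f‖ := by
  obtain ⟨l, hψm, B, hB⟩ := (Submodule.mem_iInf _).1 hψ m
  set A : ℝ := max B 1
  have hA1 : 1 ≤ A := le_max_right _ _
  have hder {j : ℕ} (hj : j ≤ m) (x : ℝ) : ‖iteratedDeriv j ψ x‖ ≤ A * (1 + |x| ^ 2) ^ l :=
    le_of_weighted_le (fun p ↦ (hB ⟨p, rfl⟩).trans (le_max_left _ _)) hj x
  refine ⟨l * 2 * n + l * m, m ! * (2 * A ^ 2) ^ n * A ^ m, fun f ↦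
    ⟨f.2.1.comp hψm, weighted_le_of_le fun j hj x ↦ ?_⟩⟩
  set w : ℝ := 1 + |x| ^ 2
  have hw : 1 ≤ w := by simp only [w]; nlinarith [sq_nonneg |x|]
  have hwl : 1 ≤ w ^ l := one_le_pow₀ hw
  have hD : 1 ≤ A * w ^ l := one_le_mul_of_one_le_of_one_le hA1 hwl
  have hf0 : 0 ≤ ‖f‖ := norm_nonneg f
  have hjm : (j : WithTop ℕ∞) ≤ (m : WithTop ℕ∞) := by exact_mod_cast hj
  have key := norm_iteratedFDeriv_comp_le (n := j) f.2.1 hψm hjm x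
    (C := ‖f‖ * (1 + |ψ x| ^ 2) ^ n) (D := A * w ^ l)
    (fun i hi ↦ by
      rw [norm_iteratedFDeriv_eq_norm_iteratedDeriv]
      exact le_of_weighted_le (weighted_le_norm 𝕜 f) (hi.trans hj) _)
    (fun i hi hij ↦ by
      rw [norm_iteratedFDeriv_eq_norm_iteratedDeriv]
      exact (hder (hij.trans hj) x).trans (le_self_pow₀ hD (by omega)))
  rw [norm_iteratedFDeriv_eq_norm_iteratedDeriv] at key
  have hψx : 1 + |ψ x| ^ 2 ≤ 2 * A ^ 2 * w ^ (l * 2) := by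
    have h0 := hder (Nat.zero_le m) x
    rw [iteratedDeriv_zero, Real.norm_eq_abs] at h0
    have h1 : |ψ x| ^ 2 ≤ (A * w ^ l) ^ 2 := by gcongr
    have h2 : 1 ≤ (A * w ^ l) ^ 2 := one_le_pow₀ hD
    calc 1 + |ψ x| ^ 2 ≤ 2 * (A * w ^ l) ^ 2 := by linarith
      _ = _ := by ring
  calc ‖iteratedDeriv j (f.1 ∘ ψ) x‖
      ≤ j ! * (‖f‖ * (1 + |ψ x| ^ 2) ^ n) * (A * w ^ l) ^ j := key
    _ ≤ m ! * (‖f‖ * (2 * A ^ 2 * w ^ (l * 2)) ^ n) * (A * w ^ l) ^ m := by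
        gcongr
    _ = m ! * (2 * A ^ 2) ^ n * A ^ m * ‖f‖ * w ^ (l * 2 * n + l * m) := by
        rw [pow_add, pow_mul, pow_mul w l m]; ring

theorem comp_mem_level (hψ : ψ ∈ omSubmodule ℝ) {m : ℕ} {f : ℝ → 𝕜}
    (hf : f ∈ levelSubmodule 𝕜 m) : f ∘ ψ ∈ levelSubmodule 𝕜 m := by
  obtain ⟨n, hn⟩ := hf
  obtain ⟨k, A, h⟩ := exists_comp_bound 𝕜 hψ m n
  let F : OStep 𝕜 m n := ⟨f, hn⟩
  obtain ⟨h1, h2⟩ := h F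
  refine ⟨k, h1, A * ‖F‖, ?_⟩
  rintro _ ⟨p, rfl⟩
  exact h2 p

/-- The operator `f ↦ f ∘ ψ` on `𝒪ᵐ(ℝ)`. -/
def levelComp (hψ : ψ ∈ omSubmodule ℝ) (m : ℕ) : OLevel 𝕜 m →ₗ[𝕜] OLevel 𝕜 m where
  toFun f := ⟨f.1 ∘ ψ, comp_mem_level 𝕜 hψ f.2⟩
  map_add' _ _ := rfl
  map_smul' _ _ := rfl

theorem continuous_levelComp_stepIncl (hψ : ψ ∈ omSubmodule ℝ) (m n : ℕ) :
    Continuous fun f ↦ levelComp 𝕜 hψ m (stepIncl 𝕜 m n f) := by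
  obtain ⟨k, A, h⟩ := exists_comp_bound 𝕜 hψ m n
  have hmem (f : OStep 𝕜 m n) : f.1 ∘ ψ ∈ stepSubmodule 𝕜 m k :=
    ⟨(h f).1, A * ‖f‖, by rintro _ ⟨p, rfl⟩; exact (h f).2 p⟩
  let L : OStep 𝕜 m n →ₗ[𝕜] OStep 𝕜 m k :=
    { toFun := fun f ↦ ⟨f.1 ∘ ψ, hmem f⟩
      map_add' := fun _ _ ↦ rfl
      map_smul' := fun _ _ ↦ rfl }
  have hL : Continuous L := (L.mkContinuous A fun f ↦ ciSup_le (h f).2).continuous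
  exact (continuous_stepIncl 𝕜 m k).comp hL

theorem continuous_levelComp (hψ : ψ ∈ omSubmodule ℝ) (m : ℕ) :
    Continuous (levelComp 𝕜 hψ m) := by
  rw [continuous_iff_le_induced]
  refine sInf_le ⟨fun n ↦ continuous_induced_rng.2 (continuous_levelComp_stepIncl 𝕜 hψ m n),
    topologicalAddGroup_induced (levelComp 𝕜 hψ m), continuousSMul_induced (levelComp 𝕜 hψ m), ?_⟩
  exact LocallyConvexSpace.induced
    ({ toFun := levelComp 𝕜 hψ m
       map_add' := fun _ _ ↦ rfl
       map_smul' := fun _ _ ↦ rfl } : OLevel 𝕜 m →ₗ[ℝ] OLevel 𝕜 m)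

/-- The composition operator `C_ψ : 𝒪_M(ℝ) → 𝒪_M(ℝ)`, `f ↦ f ∘ ψ`, for `ψ ∈ 𝒪_M(ℝ)` real valued. -/
def compositionOperator (ψ : ℝ → ℝ) (hψ : ψ ∈ omSubmodule ℝ) : OM 𝕜 →L[𝕜] OM 𝕜 where
  toFun f := ⟨f.1 ∘ ψ, (Submodule.mem_iInf _).2 fun m ↦
    comp_mem_level 𝕜 hψ ((Submodule.mem_iInf _).1 f.2 m)⟩
  map_add' _ _ := rfl
  map_smul' _ _ := rfl
  cont := continuous_iInf_rng.2 fun m ↦ continuous_induced_rng.2 <|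
    (continuous_levelComp 𝕜 hψ m).comp (continuous_levelIncl 𝕜 m)

end Composition

/-- The iterates `ψ_n`, `n ∈ ℤ`, of a bijection `ψ` of the line: `ψ_0 = id`, `ψ_n = ψ ∘ ψ_{n-1}`
and `ψ_{-n}` is the inverse of `ψ_n`. -/
def iter (ψ : ℝ → ℝ) (hψ : Function.Bijective ψ) (n : ℤ) : ℝ → ℝ :=
  ⇑((Equiv.ofBijective ψ hψ : Equiv.Perm ℝ) ^ n)

variable {𝕜} in
/-- A continuous linear operator is sequentially hypercyclic if some orbit `{g, Tg, T²g, …}` is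
sequentially dense: every vector is the limit of a sequence of elements of the orbit. -/
def IsSequentiallyHypercyclic {E : Type*} [AddCommGroup E] [Module 𝕜 E] [TopologicalSpace E]
    (T : E →L[𝕜] E) : Prop :=
  ∃ g : E, seqClosure (range fun n : ℕ ↦ T^[n] g) = univ

end SlowGrowth

end

open Set Filter Topology
open scoped Nat ContDiff

noncomputable section

namespace SlowGrowth

variable {𝕜 : Type*} [RCLike 𝕜]

/-! Take test functions `d k` such that every `f` in 𝒪_M is the limit of some `d (k i)` with `k i →
∞`, and put `G = ∑ d j ∘ ψ_{-t j}` for rapidly growing times `t j`. Then `C_ψ^{t k} G = d k + S k`,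
where `S k` is the sum of `d j ∘ ψ_{t k - t j}` over `j ≠ k`. If `S k → 0` in 𝒪_M, the orbit of `G`
is sequentially dense.

For the smallness of `S k`, let `p = max j k`. Without fixed points, high iterates of `ψ`, forward
or backward, move `[-B p, B p]` off itself (`exists_separating_times`). If this interval contains
the support of `d j`, the term vanishes on it. Outside it, the weight `1 + x²` exceeds `1 + (B p)²`,
which is chosen to dominate `4^p` times the derivatives of `d j`: one extra power of the weight buys
a factor `4^{-p} ≤ 2^{-k} 2^{-j}`, summable in `j` and null in `k`.

The chain rule also brings in derivatives of the iterates. Boundedness of the `(ψ_n)'` in 𝒪_M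
controls them by one polynomial weight for all `n`, because a bounded set of 𝒪_M is, for each `m`,
bounded in a single step (`exists_bound_of_isVonNBounded`). -/

theorem one_le_weight (x : ℝ) : 1 ≤ 1 + |x| ^ 2 := le_add_of_nonneg_right (by positivity)

/-! ### Estimates describing 𝒪_M and its convergent sequences -/

theorem mem_omSubmodule_iff {f : ℝ → 𝕜} :
    f ∈ omSubmodule 𝕜 ↔ ContDiff ℝ ∞ f ∧ ∀ m : ℕ, ∃ (n : ℕ) (C : ℝ), ∀ j ≤ m, ∀ x,
      ‖iteratedDeriv j f x‖ ≤ C * (1 + |x| ^ 2) ^ n := by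
  constructor
  · intro hf
    have h (m : ℕ) := (Submodule.mem_iInf _).1 hf m
    refine ⟨contDiff_infty.2 fun m ↦ ?_, fun m ↦ ?_⟩
    · obtain ⟨n, hn⟩ := h m
      exact hn.1
    · obtain ⟨n, -, C, hC⟩ := h m
      exact ⟨n, C, fun j hj x ↦ le_of_weighted_le (fun p ↦ hC ⟨p, rfl⟩) hj x⟩
  · rintro ⟨hf, h⟩
    refine (Submodule.mem_iInf _).2 fun m ↦ ?_
    obtain ⟨n, C, hC⟩ := h m
    refine ⟨n, contDiff_infty.1 hf m, C, ?_⟩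
    rintro _ ⟨p, rfl⟩
    exact weighted_le_of_le hC p

/-- A sequence of functions tends to zero with weights: for each `m`, it is eventually in some
`𝒪ₙᵐ(ℝ)` and tends to zero in the norm of this space. -/
def IsWeightedNull (u : ℕ → ℝ → 𝕜) : Prop :=
  ∀ m : ℕ, ∃ (n : ℕ) (c : ℕ → ℝ), Tendsto c atTop (𝓝 0) ∧ ∀ᶠ i in atTop,
    ContDiff ℝ m (u i) ∧ ∀ j ≤ m, ∀ x, ‖iteratedDeriv j (u i) x‖ ≤ c i * (1 + |x| ^ 2) ^ n

theorem IsWeightedNull.add {u v : ℕ → ℝ → 𝕜} (hu : IsWeightedNull u) (hv : IsWeightedNull v) :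
    IsWeightedNull fun i ↦ u i + v i := by
  intro m
  obtain ⟨a, c, hc, hu⟩ := hu m
  obtain ⟨b, d, hd, hv⟩ := hv m
  refine ⟨a + b, fun i ↦ c i + d i, by simpa using hc.add hd, ?_⟩
  filter_upwards [hu, hv] with i hu hv
  refine ⟨hu.1.add hv.1, fun j hj x ↦ ?_⟩
  have hjm : (j : WithTop ℕ∞) ≤ (m : WithTop ℕ∞) := by exact_mod_cast hj
  have hc0 : 0 ≤ c i := by
    simpa using (norm_nonneg _).trans (hu.2 0 (Nat.zero_le m) 0)
  have hd0 : 0 ≤ d i := by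
    simpa using (norm_nonneg _).trans (hv.2 0 (Nat.zero_le m) 0)
  rw [iteratedDeriv_add (hu.1.of_le hjm).contDiffAt (hv.1.of_le hjm).contDiffAt, add_mul]
  refine (norm_add_le _ _).trans (add_le_add ((hu.2 j hj x).trans ?_) ((hv.2 j hj x).trans ?_))
  · gcongr
    · exact one_le_weight x
    · omega
  · gcongr
    · exact one_le_weight x
    · omega

theorem IsWeightedNull.comp_tendsto {u : ℕ → ℝ → 𝕜} (hu : IsWeightedNull u) {k : ℕ → ℕ}
    (hk : Tendsto k atTop atTop) : IsWeightedNull fun i ↦ u (k i) := by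
  intro m
  obtain ⟨a, c, hc, hu⟩ := hu m
  exact ⟨a, c ∘ k, hc.comp hk, hk.eventually hu⟩

theorem tendsto_of_isWeightedNull {h : ℕ → OM 𝕜} {f : OM 𝕜}
    (H : IsWeightedNull fun i ↦ (h i).1 - f.1) : Tendsto h atTop (𝓝 f) := by
  rw [nhds_iInf, tendsto_iInf]
  intro m
  rw [nhds_induced, tendsto_comap_iff]
  obtain ⟨n, c, hc, hb⟩ := H m
  have hmem : ∀ᶠ i in atTop, (h i).1 - f.1 ∈ stepSubmodule 𝕜 m n := by
    filter_upwards [hb] with i hi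
    refine ⟨hi.1, c i, ?_⟩
    rintro _ ⟨p, rfl⟩
    exact weighted_le_of_le hi.2 p
  classical
  -- The value 0 only fills in the finitely many indices at which the difference may not yet lie in
  -- the step.
  let e : ℕ → OStep 𝕜 m n := fun i ↦
    if hi : (h i).1 - f.1 ∈ stepSubmodule 𝕜 m n then ⟨_, hi⟩ else 0
  have he : Tendsto e atTop (𝓝 0) := by
    refine squeeze_zero_norm' ?_ hc
    filter_upwards [hb, hmem] with i hi hi'
    have : e i = ⟨_, hi'⟩ := dif_pos hi'
    rw [this]
    exact ciSup_le (weighted_le_of_le hi.2)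
  have hs : Tendsto (fun i ↦ stepIncl 𝕜 m n (e i) + levelIncl 𝕜 m f) atTop
      (𝓝 (levelIncl 𝕜 m f)) := by
    simpa using (((continuous_stepIncl 𝕜 m n).tendsto 0).comp he).add_const (levelIncl 𝕜 m f)
  refine hs.congr' ?_
  filter_upwards [hmem] with i hi
  have : e i = ⟨_, hi⟩ := dif_pos hi
  rw [this]
  exact Subtype.ext (sub_add_cancel (h i).1 f.1)

/-! ### Bounded subsets of 𝒪_M -/

/-- The topology induced by `L` is one of those whose infimum defines the inductive limit. -/
theorem continuous_of_continuous_stepIncl {E : Type*} [NormedAddCommGroup E] [NormedSpace ℝ E]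
    {m : ℕ} (L : OLevel ℝ m →ₗ[ℝ] E) (h : ∀ n, Continuous fun f ↦ L (stepIncl ℝ m n f)) :
    Continuous L := by
  rw [continuous_iff_le_induced]
  exact sInf_le ⟨fun n ↦ continuous_induced_rng.2 (h n), topologicalAddGroup_induced L,
    continuousSMul_induced L, LocallyConvexSpace.induced L⟩

/-- For `k ≥ n` the weight of exponent `k` beats the growth allowed in the step `n`; the finitely
many `k < n` are absorbed in `K`. Hence one sampling operator works on all steps at once. -/
theorem exists_weightedSample_bound (m n : ℕ) (q : ℕ → ℝ × Fin (m + 1)) :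
    ∃ K : ℝ, ∀ (f : OStep ℝ m n) (k : ℕ),
      ‖((1 + |(q k).1| ^ 2) ^ k)⁻¹ * iteratedDeriv (q k).2 f.1 (q k).1‖ ≤ K * ‖f‖ := by
  refine ⟨1 + ∑ k ∈ Finset.range n, (1 + |(q k).1| ^ 2) ^ n, fun f k ↦ ?_⟩
  have hw := one_le_weight (q k).1
  set w : ℕ → ℝ := fun k ↦ 1 + |(q k).1| ^ 2
  change 1 ≤ w k at hw
  have hs : 0 ≤ ∑ k ∈ Finset.range n, w k ^ n :=
    Finset.sum_nonneg fun k _ ↦ by simp only [w]; positivity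
  have hf : ‖iteratedDeriv (q k).2 f.1 (q k).1‖ ≤ ‖f‖ * w k ^ n :=
    le_of_weighted_le (weighted_le_norm ℝ f) (Nat.lt_succ_iff.mp (q k).2.2) _
  have hK : w k ^ n ≤ (1 + ∑ k ∈ Finset.range n, w k ^ n) * w k ^ k := by
    rcases lt_or_ge k n with hk | hk
    · have h1 : w k ^ n ≤ ∑ k ∈ Finset.range n, w k ^ n :=
        Finset.single_le_sum (f := fun k ↦ w k ^ n)
          (fun k _ ↦ by simp only [w]; positivity) (Finset.mem_range.2 hk)
      have h2 : 1 ≤ w k ^ k := one_le_pow₀ hw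
      nlinarith
    · have h1 : w k ^ n ≤ w k ^ k := pow_le_pow_right₀ hw hk
      have h2 : 1 ≤ w k ^ k := one_le_pow₀ hw
      nlinarith
  rw [norm_mul, norm_inv, norm_pow, Real.norm_of_nonneg (zero_le_one.trans hw),
    inv_mul_le_iff₀ (by positivity)]
  nlinarith [norm_nonneg f]

theorem exists_weightedSample_bound_level (m : ℕ) (q : ℕ → ℝ × Fin (m + 1)) (f : OLevel ℝ m) :
    ∃ C : ℝ, ∀ k : ℕ,
      ‖((1 + |(q k).1| ^ 2) ^ k)⁻¹ * iteratedDeriv (q k).2 f.1 (q k).1‖ ≤ C := by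
  obtain ⟨n, hn⟩ := f.2
  obtain ⟨K, hK⟩ := exists_weightedSample_bound m n q
  let F : OStep ℝ m n := ⟨f.1, hn⟩
  exact ⟨K * ‖F‖, hK F⟩

/-- A sequence of point evaluations of derivatives, the `k`-th one with the weight
`(1 + |x|²)^(-k)`, as an operator with values in the bounded sequences. -/
def weightedSampling (m : ℕ) (q : ℕ → ℝ × Fin (m + 1)) :
    OLevel ℝ m →ₗ[ℝ] BoundedContinuousFunction ℕ ℝ where
  toFun f := BoundedContinuousFunction.ofNormedAddCommGroup
    (fun k ↦ ((1 + |(q k).1| ^ 2) ^ k)⁻¹ * iteratedDeriv (q k).2 f.1 (q k).1)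
    continuous_of_discreteTopology
    _ (exists_weightedSample_bound_level m q f).choose_spec
  map_add' f g := by
    ext k
    obtain ⟨a, ha⟩ := f.2
    obtain ⟨b, hb⟩ := g.2
    have hj : (((q k).2 : ℕ) : WithTop ℕ∞) ≤ (m : WithTop ℕ∞) := by
      exact_mod_cast Nat.lt_succ_iff.mp (q k).2.2
    change _ * iteratedDeriv (q k).2 (f.1 + g.1) (q k).1 = _ + _
    rw [iteratedDeriv_add (ha.1.of_le hj).contDiffAt (hb.1.of_le hj).contDiffAt, mul_add]
    rfl
  map_smul' c f := by
    ext k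
    change _ * iteratedDeriv (q k).2 (c • f.1) (q k).1 = c * (_ * _)
    rw [iteratedDeriv_const_smul_field, smul_eq_mul]
    ring

theorem continuous_weightedSampling (m : ℕ) (q : ℕ → ℝ × Fin (m + 1)) :
    Continuous (weightedSampling m q) := by
  refine continuous_of_continuous_stepIncl _ fun n ↦ ?_
  obtain ⟨K, hK⟩ := exists_weightedSample_bound m n q
  refine ((weightedSampling m q ∘ₗ stepIncl ℝ m n).mkContinuous |K| fun f ↦ ?_).continuous
  refine (BoundedContinuousFunction.norm_le (by positivity)).2 fun k ↦ (hK f k).trans ?_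
  gcongr
  exact le_abs_self K

/-- A bounded subset of `𝒪_M(ℝ)` is, for each `m`, contained and bounded in some `𝒪ₙᵐ(ℝ)`. -/
theorem exists_bound_of_isVonNBounded {ι : Type*} {F : ι → OM ℝ}
    (hF : Bornology.IsVonNBounded ℝ (range F)) (m : ℕ) :
    ∃ (l : ℕ) (A : ℝ), ∀ i, ∀ j ≤ m, ∀ x,
      ‖iteratedDeriv j (F i).1 x‖ ≤ A * (1 + |x| ^ 2) ^ l := by
  by_contra! H
  -- Test the failure with exponent and constant both equal to `k`. Sampling at these points is
  -- continuous on 𝒪_M, so it keeps the family bounded, yet the `k`-th coordinate of the `k`-th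
  -- witness exceeds `k`.
  choose i j hj x hx using fun k : ℕ ↦ H k k
  let q : ℕ → ℝ × Fin (m + 1) := fun k ↦ (x k, ⟨j k, Nat.lt_succ_of_le (hj k)⟩)
  let L : OM ℝ →L[ℝ] BoundedContinuousFunction ℕ ℝ :=
    ⟨weightedSampling m q ∘ₗ levelIncl ℝ m,
      (continuous_weightedSampling m q).comp (continuous_levelIncl ℝ m)⟩
  obtain ⟨r, hr⟩ := (NormedSpace.isVonNBounded_iff' ℝ).1 (hF.image L)
  obtain ⟨k, hk⟩ := exists_nat_gt r
  have h1 : ‖L (F (i k)) k‖ ≤ r :=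
    ((L (F (i k))).norm_coe_le_norm k).trans (hr _ ⟨_, ⟨_, rfl⟩, rfl⟩)
  have h2 : L (F (i k)) k = ((1 + |x k| ^ 2) ^ k)⁻¹ * iteratedDeriv (j k) (F (i k)).1 (x k) := rfl
  have hw := one_le_weight (x k)
  rw [h2, norm_mul, norm_inv, norm_pow, Real.norm_of_nonneg (zero_le_one.trans hw),
    inv_mul_le_iff₀ (by positivity)] at h1
  have h3 : (1 + |x k| ^ 2) ^ k * r ≤ k * (1 + |x k| ^ 2) ^ k := by
    rw [mul_comm]
    gcongr
  exact (h1.trans h3).not_gt (hx k)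

/-! ### Iterates of a fixed point free diffeomorphism -/

section Iterates

variable {ψ : ℝ → ℝ} (hbij : Function.Bijective ψ)

theorem iter_natCast (n : ℕ) : iter ψ hbij n = ψ^[n] := by
  unfold iter
  rw [zpow_natCast, ← Equiv.Perm.iterate_eq_pow]
  rfl

theorem iter_add (a b : ℤ) (x : ℝ) : iter ψ hbij (a + b) x = iter ψ hbij a (iter ψ hbij b x) := by
  unfold iter
  rw [zpow_add]
  rfl

theorem iter_zero (x : ℝ) : iter ψ hbij 0 x = x := rfl

theorem contDiff_iter (hψ : ContDiff ℝ ∞ ψ) (hderiv : ∀ x, 0 < deriv ψ x) (n : ℤ) :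
    ContDiff ℝ ∞ (iter ψ hbij n) := by
  have hpos (n : ℕ) : ContDiff ℝ ∞ (iter ψ hbij n) := by
    rw [iter_natCast]
    induction n with
    | zero => exact contDiff_id
    | succ n ih => exact ih.comp hψ
  let e : ℝ ≃ₜ ℝ :=
    ((strictMono_of_deriv_pos hderiv).orderIsoOfSurjective ψ hbij.2).toHomeomorph
  have hs : ContDiff ℝ ∞ e.symm := e.contDiff_symm_deriv (fun x ↦ (hderiv x).ne')
    (fun x ↦ (hψ.differentiable (by simp) x).hasDerivAt) hψ
  have he : iter ψ hbij (-1) = e.symm := by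
    funext x
    obtain ⟨y, rfl⟩ := e.surjective x
    rw [e.symm_apply_apply]
    have := iter_add hbij (-1) 1 y
    rw [neg_add_cancel, iter_zero] at this
    exact this.symm
  obtain ⟨k, rfl | rfl⟩ := n.eq_nat_or_neg
  · exact hpos k
  · induction k with
    | zero => exact hpos 0
    | succ k ih =>
      have h : iter ψ hbij (-((k + 1 : ℕ) : ℤ)) = iter ψ hbij (-1) ∘ iter ψ hbij (-k) := by
        funext x
        rw [Function.comp_apply, ← iter_add]
        congr 1
        push_cast
        ring
      rw [h, he]
      exact hs.comp ih

theorem forall_lt_or_forall_gt_of_fixedPointFree (hψ : Continuous ψ) (hfix : ∀ x, ψ x ≠ x) :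
    (∀ x, x < ψ x) ∨ ∀ x, ψ x < x := by
  by_contra! H
  obtain ⟨⟨a, ha⟩, b, hb⟩ := H
  obtain ⟨c, hc⟩ := mem_range_of_exists_le_of_exists_ge (f := fun x ↦ ψ x - x) (by fun_prop)
    ⟨a, sub_nonpos.2 ha⟩ ⟨b, sub_nonneg.2 hb⟩
  exact hfix c (sub_eq_zero.1 hc)

/-- The displacement `f x - x` has a positive minimum on `[-R, R]`. An orbit starting there gains at
least this much at each step until it passes `R`, and never comes back since `f` increases every
point. -/
theorem exists_forall_lt_of_lt_apply {f : ℝ → ℝ} (hf : Continuous f) (h : ∀ x, x < f x) (R : ℝ) :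
    ∃ N : ℕ, ∀ n ≥ N, ∀ x, |x| ≤ R → R < |f^[n] x| := by
  rcases lt_or_ge R 0 with hR | hR
  · exact ⟨0, fun n _ x hx ↦ absurd ((abs_nonneg x).trans hx) hR.not_ge⟩
  obtain ⟨z, -, hz⟩ := (isCompact_Icc (a := -R) (b := R)).exists_isMinOn
    ⟨0, by simpa using hR⟩ (f := fun x ↦ f x - x) (by fun_prop)
  have hδ : 0 < f z - z := sub_pos.2 (h z)
  obtain ⟨N, hN⟩ := exists_nat_gt (2 * R / (f z - z))
  rw [div_lt_iff₀ hδ] at hN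
  refine ⟨N, fun n hn x hx ↦ ?_⟩
  have key (n : ℕ) : R < f^[n] x ∨ x + n * (f z - z) ≤ f^[n] x := by
    induction n with
    | zero => right; simp
    | succ n ih =>
      rw [Function.iterate_succ_apply']
      rcases ih with ih | ih
      · exact .inl (ih.trans (h _))
      · rcases lt_or_ge R (f^[n] x) with h1 | h1
        · exact .inl (h1.trans (h _))
        · right
          have h2 : f z - z ≤ f (f^[n] x) - f^[n] x := by
            refine hz ⟨?_, h1⟩
            have : 0 ≤ n * (f z - z) := by positivity
            linarith [(abs_le.1 hx).1]
          push_cast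
          linarith
  refine lt_of_lt_of_le ?_ (le_abs_self _)
  rcases key n with h1 | h1
  · exact h1
  · have h2 : (N : ℝ) * (f z - z) ≤ n * (f z - z) := by gcongr
    linarith [(abs_le.1 hx).1]

theorem exists_forall_lt_iterate (hψ : Continuous ψ) (hfix : ∀ x, ψ x ≠ x) (R : ℝ) :
    ∃ N : ℕ, ∀ n ≥ N, ∀ x, |x| ≤ R → R < |ψ^[n] x| := by
  rcases forall_lt_or_forall_gt_of_fixedPointFree hψ hfix with h | h
  · exact exists_forall_lt_of_lt_apply hψ h R
  -- The reflection `x ↦ -x` conjugates this case to the previous one.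
  · obtain ⟨N, hN⟩ := exists_forall_lt_of_lt_apply (f := fun x ↦ -ψ (-x)) (by fun_prop)
      (fun x ↦ by linarith [h (-x)]) R
    refine ⟨N, fun n hn x hx ↦ ?_⟩
    have hs : Function.Semiconj (fun x : ℝ ↦ -x) ψ (fun x ↦ -ψ (-x)) := fun x ↦ by simp
    have := hN n hn (-x) (by rwa [abs_neg])
    rwa [← hs.iterate_right n x, abs_neg] at this

/-- The iterates of a homeomorphism of the line without fixed points run away from the
compact sets, in both directions. -/
theorem exists_forall_lt_iter (hψ : Continuous ψ) (hfix : ∀ x, ψ x ≠ x) (R : ℝ) :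
    ∃ N : ℕ, ∀ n : ℤ, (N : ℤ) ≤ |n| → ∀ x, |x| ≤ R → R < |iter ψ hbij n x| := by
  obtain ⟨N, hN⟩ := exists_forall_lt_iterate hψ hfix R
  refine ⟨N, fun n hn x hx ↦ ?_⟩
  obtain ⟨k, rfl | rfl⟩ := n.eq_nat_or_neg
  · rw [iter_natCast]
    exact hN k (by simpa using hn) x hx
  -- If `ψ_{-k} x` stayed in `[-R, R]`, the forward iterate would send it outside, but it sends it
  -- back to `x`.
  · by_contra! H
    have h1 := hN k (by simpa using hn) _ H
    rw [← iter_natCast hbij, ← iter_add, add_neg_cancel, iter_zero] at h1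
    exact h1.not_ge hx

/-- With `t k = L 1 + ⋯ + L k`, any two distinct times differ by at least `L (max j k)`, the escape
time for the radius `B (max j k)`. -/
theorem exists_separating_times (hψ : Continuous ψ) (hfix : ∀ x, ψ x ≠ x) (B : ℕ → ℝ) :
    ∃ t : ℕ → ℕ, t 0 = 0 ∧ ∀ j k, j ≠ k → ∀ x, |x| ≤ B (max j k) →
      B (max j k) < |iter ψ hbij (t k - t j) x| := by
  choose L hL using fun p ↦ exists_forall_lt_iter hbij hψ hfix (B p)
  let t : ℕ → ℕ := fun k ↦ ∑ i ∈ Finset.range k, L (i + 1)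
  have hmono : Monotone t := monotone_nat_of_le_succ fun k ↦ by
    simp only [t, Finset.sum_range_succ]; omega
  have hlt {j k : ℕ} (h : j < k) : t j + L k ≤ t k := by
    obtain ⟨k, rfl⟩ := Nat.exists_eq_succ_of_ne_zero (Nat.ne_zero_of_lt h)
    have h1 : t (k + 1) = t k + L (k + 1) := Finset.sum_range_succ _ _
    have h2 := hmono (Nat.lt_succ_iff.1 h)
    simp only [Nat.succ_eq_add_one]
    omega
  refine ⟨t, rfl, fun j k hjk x hx ↦ hL _ _ ?_ x hx⟩
  rcases lt_or_gt_of_ne hjk with h | h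
  · have := hlt h
    rw [max_eq_right h.le, abs_of_nonneg (by omega)]
    omega
  · have := hlt h
    rw [max_eq_left h.le, abs_of_nonpos (by omega)]
    omega

end Iterates

/-! ### Compositions and locally finite sums -/

theorem norm_iteratedDeriv_comp_le {f : ℝ → 𝕜} {s : ℝ → ℝ} (hf : ContDiff ℝ ∞ f)
    (hs : ContDiff ℝ ∞ s) {m : ℕ} {x C D : ℝ} (hD : 1 ≤ D)
    (hC : ∀ i ≤ m, ‖iteratedDeriv i f (s x)‖ ≤ C)
    (hsD : ∀ i, 1 ≤ i → i ≤ m → ‖iteratedDeriv i s x‖ ≤ D) {i : ℕ} (hi : i ≤ m) :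
    ‖iteratedDeriv i (f ∘ s) x‖ ≤ m ! * C * D ^ m := by
  have hC0 : 0 ≤ C := (norm_nonneg _).trans (hC 0 (Nat.zero_le m))
  have key := norm_iteratedFDeriv_comp_le (n := i) (contDiff_infty.1 hf i) (contDiff_infty.1 hs i)
    le_rfl x (C := C) (D := D)
    (fun j hj ↦ by
      rw [norm_iteratedFDeriv_eq_norm_iteratedDeriv]
      exact hC j (hj.trans hi))
    (fun j hj hji ↦ by
      rw [norm_iteratedFDeriv_eq_norm_iteratedDeriv]
      exact (hsD j hj (hji.trans hi)).trans (le_self_pow₀ hD (by omega)))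
  rw [norm_iteratedFDeriv_eq_norm_iteratedDeriv] at key
  refine key.trans ?_
  gcongr

section Sum

variable {u : ℕ → ℝ → 𝕜}

/-- The sets `{1 + |x|² < 2^j}` are open and increase to the whole line, so the sum is locally
finite. -/
theorem exists_tsum_eventuallyEq (hz : ∀ j x, 1 + |x| ^ 2 < 2 ^ j → u j x = 0) (x : ℝ) :
    ∃ J, (fun y ↦ ∑' j, u j y) =ᶠ[𝓝 x] fun y ↦ ∑ j ∈ Finset.range J, u j y := by
  obtain ⟨J, hJ⟩ := pow_unbounded_of_one_lt (1 + |x| ^ 2) (one_lt_two (α := ℝ))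
  refine ⟨J, ?_⟩
  have hc : Continuous fun y : ℝ ↦ 1 + |y| ^ 2 := by fun_prop
  filter_upwards [hc.continuousAt.eventually_lt_const hJ] with y hy
  refine tsum_eq_sum fun j hj ↦ hz j y (hy.trans_le ?_)
  exact pow_le_pow_right₀ one_le_two (by simpa using hj)

theorem contDiff_tsum_of_vanish (hz : ∀ j x, 1 + |x| ^ 2 < 2 ^ j → u j x = 0)
    (hu : ∀ j, ContDiff ℝ ∞ (u j)) : ContDiff ℝ ∞ fun y ↦ ∑' j, u j y := by
  refine contDiff_iff_contDiffAt.2 fun x ↦ ?_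
  obtain ⟨J, hJ⟩ := exists_tsum_eventuallyEq hz x
  exact (ContDiff.sum fun j _ ↦ hu j).contDiffAt.congr_of_eventuallyEq hJ

theorem norm_iteratedDeriv_tsum_le (hz : ∀ j x, 1 + |x| ^ 2 < 2 ^ j → u j x = 0)
    (hu : ∀ j, ContDiff ℝ ∞ (u j)) {c : ℕ → ℝ} (hc : Summable c) {i : ℕ} {x w : ℝ}
    (hw : 0 < w)
    (h : ∀ j, ‖iteratedDeriv i (u j) x‖ ≤ c j * w) :
    ‖iteratedDeriv i (fun y ↦ ∑' j, u j y) x‖ ≤ (∑' j, c j) * w := by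
  obtain ⟨J, hJ⟩ := exists_tsum_eventuallyEq hz x
  rw [hJ.iteratedDeriv_eq, iteratedDeriv_fun_sum fun j _ ↦ (contDiff_infty.1 (hu j) i).contDiffAt]
  have hc0 (j : ℕ) : 0 ≤ c j := nonneg_of_mul_nonneg_left ((norm_nonneg _).trans (h j)) hw
  calc _ ≤ ∑ j ∈ Finset.range J, c j * w := norm_sum_le_of_le _ fun j _ ↦ h j
    _ = (∑ j ∈ Finset.range J, c j) * w := (Finset.sum_mul ..).symm
    _ ≤ _ := by
      gcongr
      exact hc.sum_le_tsum _ fun j _ ↦ hc0 j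

end Sum

/-! ### Test functions and their sequential density -/

/-- A smooth function which vanishes outside of `[-R, R]`. -/
def IsTestFunction (R : ℝ) (f : ℝ → 𝕜) : Prop :=
  ContDiff ℝ ∞ f ∧ ∀ y, R < |y| → f y = 0

theorem IsTestFunction.iteratedDeriv_eq_zero {R : ℝ} {f : ℝ → 𝕜} (hf : IsTestFunction R f)
    (i : ℕ) {y : ℝ} (hy : R < |y|) : iteratedDeriv i f y = 0 := by
  have h : f =ᶠ[𝓝 y] fun _ ↦ 0 := by
    filter_upwards [continuous_abs.continuousAt.eventually_const_lt hy] with z hz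
    exact hf.2 z hz
  rw [h.iteratedDeriv_eq, iteratedDeriv_const]
  simp

theorem IsTestFunction.sub {R : ℝ} {f g : ℝ → 𝕜} (hf : IsTestFunction R f)
    (hg : IsTestFunction R g) : IsTestFunction R (f - g) :=
  ⟨hf.1.sub hg.1, fun y hy ↦ by simp [hf.2 y hy, hg.2 y hy]⟩

theorem IsTestFunction.exists_bound {R : ℝ} {f : ℝ → 𝕜} (hf : IsTestFunction R f) (m : ℕ) :
    ∃ C, ∀ i ≤ m, ∀ y, ‖iteratedDeriv i f y‖ ≤ C := by
  choose C hC using fun i : ℕ ↦ (isCompact_Icc (a := -R) (b := R)).exists_bound_of_continuousOn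
    (hf.1.continuous_iteratedDeriv i (by exact_mod_cast le_top)).continuousOn
  refine ⟨∑ i ∈ Finset.range (m + 1), |C i|, fun i hi y ↦ ?_⟩
  rcases lt_or_ge R |y| with hy | hy
  · rw [hf.iteratedDeriv_eq_zero i hy, norm_zero]
    positivity
  · calc _ ≤ |C i| := (hC i y (abs_le.1 hy)).trans (le_abs_self _)
      _ ≤ _ := Finset.single_le_sum (f := fun i ↦ |C i|) (fun i _ ↦ abs_nonneg _)
        (Finset.mem_range.2 (Nat.lt_succ_of_le hi))

variable (𝕜) in
/-- The test functions with support in `[-N, N]` are separable for the norm of `C^N`. -/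
theorem exists_dense_testFunctions (N : ℕ) :
    ∃ D : ℕ → ℝ → 𝕜, (∀ i, IsTestFunction N (D i)) ∧ ∀ f : ℝ → 𝕜, IsTestFunction N f →
      ∀ ε > 0, ∃ i, ∀ j ≤ N, ∀ x, ‖iteratedDeriv j (D i - f) x‖ ≤ ε := by
  let K : Set ℝ := Icc (-N) N
  -- Tuples of continuous functions on a compact interval form a separable metric space, so the
  -- range of `J` has a dense sequence consisting of its own members.
  let J (f : {f : ℝ → 𝕜 // IsTestFunction N f}) (j : Fin (N + 1)) : C(K, 𝕜) :=
    ⟨fun x ↦ iteratedDeriv j f.1 x,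
      (f.2.1.continuous_iteratedDeriv j (by exact_mod_cast le_top)).comp continuous_subtype_val⟩
  let z : {f : ℝ → 𝕜 // IsTestFunction N f} := ⟨0, contDiff_const, fun _ _ ↦ rfl⟩
  have : Nonempty (range J) := ⟨⟨_, z, rfl⟩⟩
  let s := TopologicalSpace.denseSeq (range J)
  choose D hD using fun i ↦ (s i).2
  refine ⟨fun i ↦ (D i).1, fun i ↦ (D i).2, fun f hf ε hε ↦ ?_⟩
  obtain ⟨i, hi⟩ := (TopologicalSpace.denseRange_denseSeq (range J)).exists_dist_lt
    ⟨J ⟨f, hf⟩, _, rfl⟩ hε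
  refine ⟨i, fun j hj x ↦ ?_⟩
  rcases lt_or_ge (N : ℝ) |x| with hx | hx
  · rw [((D i).2.sub hf).iteratedDeriv_eq_zero j hx, norm_zero]
    exact hε.le
  · have h1 : dist (J ⟨f, hf⟩) (J (D i)) < ε := by
      rw [hD i]
      exact hi
    have h2 := (dist_pi_lt_iff hε).1 h1 ⟨j, Nat.lt_succ_of_le hj⟩
    have h3 := (ContinuousMap.dist_lt_iff hε).1 h2 ⟨x, abs_le.1 hx⟩
    have hjN : (j : WithTop ℕ∞) ≤ ∞ := by exact_mod_cast le_top
    rw [iteratedDeriv_sub ((D i).2.1.of_le hjN).contDiffAt (hf.1.of_le hjN).contDiffAt,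
      ← dist_eq_norm, dist_comm]
    exact h3.le

theorem exists_smooth_cutoff : ∃ χ : ℝ → ℝ, IsTestFunction 1 χ ∧ ∀ x, |x| ≤ 1 / 2 → χ x = 1 := by
  let b : ContDiffBump (0 : ℝ) := ⟨1 / 2, 1, by norm_num, by norm_num⟩
  refine ⟨b, ⟨b.contDiff, fun y hy ↦ b.zero_of_le_dist ?_⟩,
    fun x hx ↦ b.one_of_mem_closedBall ?_⟩
  · simpa using hy.le
  · rw [mem_closedBall_zero_iff]
    exact hx

/-- Cut off with `χ (x / (N + 1))`. The error lives where `|x| ≥ (N + 1) / 2`, and there one extra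
power of the weight yields a factor of order `1 / (N + 1)`. -/
theorem exists_testFunction_approx {f : ℝ → 𝕜} (hf : f ∈ omSubmodule 𝕜) :
    ∃ u : ℕ → ℝ → 𝕜, (∀ N : ℕ, IsTestFunction (N + 1 : ℕ) (u N)) ∧
      IsWeightedNull fun N ↦ u N - f := by
  obtain ⟨χ, hχ, hχ1⟩ := exists_smooth_cutoff
  obtain ⟨hfs, hfb⟩ := mem_omSubmodule_iff.1 hf
  let η : ℝ → ℝ := fun x ↦ χ x - 1
  have hη : ContDiff ℝ ∞ η := hχ.1.sub contDiff_const
  let s : ℕ → ℝ := fun N ↦ ((N : ℝ) + 1)⁻¹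
  have hs0 (N : ℕ) : 0 < s N := by simp only [s]; positivity
  have hs1 (N : ℕ) : s N ≤ 1 := inv_le_one_of_one_le₀ (by simp)
  have hηb (m : ℕ) : ∃ C, ∀ i ≤ m, ∀ y, ‖iteratedDeriv i η y‖ ≤ C := by
    obtain ⟨C, hC⟩ := hχ.exists_bound m
    refine ⟨C + 1, fun i hi y ↦ ?_⟩
    have h : iteratedDeriv i η y = iteratedDeriv i χ y - iteratedDeriv i (fun _ ↦ (1 : ℝ)) y :=
      iteratedDeriv_sub (contDiff_infty.1 hχ.1 i).contDiffAt contDiffAt_const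
    rw [h]
    refine (norm_sub_le _ _).trans (add_le_add (hC i hi y) ?_)
    rw [iteratedDeriv_const]
    split_ifs <;> simp
  refine ⟨fun N x ↦ χ (s N * x) • f x, fun N ↦ ⟨?_, fun y hy ↦ ?_⟩, fun m ↦ ?_⟩
  · exact (hχ.1.comp (contDiff_const.mul contDiff_id)).smul hfs
  · change χ (s N * y) • f y = 0
    rw [hχ.2, zero_smul]
    rw [abs_mul, abs_of_pos (hs0 N), lt_inv_mul_iff₀ (by positivity), mul_one]
    exact_mod_cast hy
  obtain ⟨n, K, hK⟩ := hfb m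
  obtain ⟨C, hC⟩ := hηb m
  have hC0 : 0 ≤ C := (norm_nonneg _).trans (hC 0 (Nat.zero_le m) 0)
  have hK0 : 0 ≤ K := by simpa using (norm_nonneg _).trans (hK 0 (Nat.zero_le m) 0)
  have hηs (N : ℕ) : ContDiff ℝ ∞ fun x ↦ η (s N * x) :=
    hη.comp (contDiff_const.mul contDiff_id)
  have he (N : ℕ) : (fun x ↦ χ (s N * x) • f x) - f = fun x ↦ η (s N * x) • f x := by
    funext x
    simp [η, sub_smul]
  refine ⟨n + 1, fun N ↦ 2 ^ m * C * K * 4 * s N, ?_, Eventually.of_forall fun N ↦ ?_⟩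
  · have := (tendsto_one_div_add_atTop_nhds_zero_nat (𝕜 := ℝ)).const_mul (2 ^ m * C * K * 4)
    simpa [s] using this
  beta_reduce
  rw [he]
  refine ⟨contDiff_infty.1 ((hηs N).smul hfs) m, fun j hj x ↦ ?_⟩
  rcases lt_or_ge (s N * |x|) (1 / 2) with hx | hx
  · have h0 : (fun x ↦ η (s N * x) • f x) =ᶠ[𝓝 x] fun _ ↦ 0 := by
      have hc : Continuous fun y : ℝ ↦ s N * |y| := by fun_prop
      filter_upwards [hc.continuousAt.eventually_lt_const hx] with y hy
      have : χ (s N * y) = 1 := hχ1 _ (by rw [abs_mul, abs_of_pos (hs0 N)]; exact hy.le)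
      simp [η, this]
    rw [h0.iteratedDeriv_eq, iteratedDeriv_const]
    have := hs0 N
    split_ifs <;> simp <;> positivity
  · set w : ℝ := 1 + |x| ^ 2
    have hw1 : 1 ≤ w := one_le_weight x
    have hw : 1 ≤ 4 * s N * w := by
      have h1 : 1 / 4 ≤ (s N * |x|) ^ 2 := by nlinarith
      have h2 : s N ^ 2 * |x| ^ 2 ≤ s N * |x| ^ 2 := by
        gcongr
        nlinarith [hs0 N, hs1 N]
      simp only [w]
      nlinarith [hs0 N]
    have key := norm_iteratedFDeriv_smul_le (contDiff_infty.1 (hηs N) j) (contDiff_infty.1 hfs j)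
      x (n := j) le_rfl
    simp only [norm_iteratedFDeriv_eq_norm_iteratedDeriv] at key
    calc _ ≤ _ := key
      _ ≤ ∑ i ∈ Finset.range (j + 1), (j.choose i : ℝ) * (C * (K * w ^ n)) := by
        refine Finset.sum_le_sum fun i hi ↦ ?_
        have hij : i ≤ j := Nat.lt_succ_iff.1 (Finset.mem_range.1 hi)
        rw [mul_assoc]
        gcongr
        · rw [iteratedDeriv_comp_const_mul (contDiff_infty.1 hη i), norm_mul, norm_pow,
            Real.norm_of_nonneg (hs0 N).le]
          exact (mul_le_of_le_one_left (norm_nonneg _) (pow_le_one₀ (hs0 N).le (hs1 N))).trans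
            (hC i (hij.trans hj) _)
        · exact hK _ ((Nat.sub_le j i).trans hj) x
      _ = 2 ^ j * (C * (K * w ^ n)) := by
        rw [← Finset.sum_mul, ← Nat.cast_sum, Nat.sum_range_choose]
        norm_cast
      _ ≤ 2 ^ m * (C * (K * w ^ n)) * 1 := by
        rw [mul_one]
        gcongr
        norm_num
      _ ≤ 2 ^ m * (C * (K * w ^ n)) * (4 * s N * w) := by gcongr
      _ = _ := by ring

variable (𝕜) in
/-- There is a sequence of test functions which is sequentially dense in `𝒪_M(ℝ)`. -/
theorem exists_sequentially_dense_testFunctions :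
    ∃ d : ℕ → ℝ → 𝕜, (∀ k, ∃ R, IsTestFunction R (d k)) ∧ ∀ f ∈ omSubmodule 𝕜,
      ∃ k : ℕ → ℕ, Tendsto k atTop atTop ∧ IsWeightedNull fun i ↦ d (k i) - f := by
  choose D hD hDd using exists_dense_testFunctions 𝕜
  refine ⟨fun k ↦ D k.unpair.1 k.unpair.2, fun k ↦ ⟨_, hD _ _⟩, fun f hf ↦ ?_⟩
  obtain ⟨u, hu, hnull⟩ := exists_testFunction_approx hf
  choose i hi using fun N : ℕ ↦ hDd (N + 1) (u N) (hu N) (1 / ((N : ℝ) + 1)) (by positivity)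
  -- Pairing with `N + 1` forces the indices to infinity, which is needed because the remainders `S
  -- k` are small only for large `k`.
  refine ⟨fun N ↦ Nat.pair (N + 1) (i N), tendsto_atTop_mono (fun N ↦ ?_) tendsto_id, ?_⟩
  · exact (Nat.le_succ N).trans (Nat.left_le_pair _ _)
  have h : IsWeightedNull fun N ↦ D (N + 1) (i N) - u N := by
    intro m
    refine ⟨0, fun N ↦ 1 / ((N : ℝ) + 1), tendsto_one_div_add_atTop_nhds_zero_nat, ?_⟩
    filter_upwards [eventually_ge_atTop m] with N hN
    refine ⟨contDiff_infty.1 ((hD _ _).1.sub (hu N).1) m, fun j hj x ↦ ?_⟩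
    rw [pow_zero, mul_one]
    exact hi N j (by omega) x
  convert h.add hnull using 2 with N
  simp

/-! ### Smallness of the off-diagonal terms -/

theorem compositionOperator_iterate {ψ : ℝ → ℝ} (hψ : ψ ∈ omSubmodule ℝ) (g : OM 𝕜) (n : ℕ) :
    ((compositionOperator 𝕜 ψ hψ)^[n] g).1 = g.1 ∘ ψ^[n] := by
  induction n with
  | zero => rfl
  | succ n ih =>
    rw [Function.iterate_succ_apply', Function.iterate_succ, ← Function.comp_assoc, ← ih]
    rfl

/-- Radii which dominate the supports and the norms of a sequence of test functions. -/
theorem exists_dominating_radii {d : ℕ → ℝ → 𝕜} {R : ℕ → ℝ}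
    (hd : ∀ j, IsTestFunction (R j) (d j)) :
    ∃ B : ℕ → ℝ, ∀ p, 0 ≤ B p ∧ 4 ^ p ≤ 1 + B p ^ 2 ∧ ∀ j ≤ p, R j ≤ B p ∧
      ∀ i ≤ p, ∀ y, 4 ^ p * ‖iteratedDeriv i (d j) y‖ ≤ 1 + B p ^ 2 := by
  choose M hM using fun p j ↦ (hd j).exists_bound p
  refine ⟨fun p ↦ 4 ^ p + ∑ j ∈ Finset.range (p + 1), (|R j| + 4 ^ p * |M p j|), fun p ↦ ?_⟩
  have hs : 0 ≤ ∑ j ∈ Finset.range (p + 1), (|R j| + 4 ^ p * |M p j|) := by positivity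
  have h4 : (1 : ℝ) ≤ 4 ^ p := one_le_pow₀ (by norm_num)
  set B := (4 : ℝ) ^ p + ∑ j ∈ Finset.range (p + 1), (|R j| + 4 ^ p * |M p j|) with hB
  have hB2 : B ≤ 1 + B ^ 2 := by nlinarith
  refine ⟨by positivity, by linarith, fun j hj ↦ ?_⟩
  have h1 : |R j| + 4 ^ p * |M p j| ≤ ∑ j ∈ Finset.range (p + 1), (|R j| + 4 ^ p * |M p j|) :=
    Finset.single_le_sum (f := fun j ↦ |R j| + 4 ^ p * |M p j|) (fun j _ ↦ by positivity)
      (Finset.mem_range.2 (Nat.lt_succ_of_le hj))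
  have h2 : 0 ≤ 4 ^ p * |M p j| := by positivity
  refine ⟨by linarith [le_abs_self (R j)], fun i hi y ↦ ?_⟩
  have h3 : 4 ^ p * ‖iteratedDeriv i (d j) y‖ ≤ 4 ^ p * |M p j| := by
    gcongr
    exact (hM p j i hi y).trans (le_abs_self _)
  linarith [abs_nonneg (R j)]

/-- Since `2 * max j k ≥ j + k`, the gain splits into a null factor in `k` and a summable one in
`j`. -/
theorem quarter_pow_max_le (j k : ℕ) : ((1 : ℝ) / 4) ^ max j k ≤ (1 / 2) ^ k * (1 / 2) ^ j := by
  have h : ((1 : ℝ) / 4) ^ max j k = (1 / 2) ^ (2 * max j k) := by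
    rw [pow_mul]
    norm_num
  rw [h, ← pow_add]
  exact pow_le_pow_of_le_one (by norm_num) (by norm_num) (by omega)

/-- A composition with an iterate which moves `[-B, B]` outside of `[-B, B]`, with `B` large
compared to the test function, is small. -/
theorem norm_iteratedDeriv_comp_le_of_escape {f : ℝ → 𝕜} {s : ℝ → ℝ} {R B A : ℝ} {m p l : ℕ}
    (hf : IsTestFunction R f) (hs : ContDiff ℝ ∞ s) (hA : 1 ≤ A)
    (hsA : ∀ i, 1 ≤ i → i ≤ m → ∀ x, ‖iteratedDeriv i s x‖ ≤ A * (1 + |x| ^ 2) ^ l)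
    (hB : 0 ≤ B) (hRB : R ≤ B) (hmp : m ≤ p)
    (hfB : ∀ i ≤ p, ∀ y, 4 ^ p * ‖iteratedDeriv i f y‖ ≤ 1 + B ^ 2)
    (hesc : ∀ x, |x| ≤ B → B < |s x|) {i : ℕ} (hi : i ≤ m) (x : ℝ) :
    ‖iteratedDeriv i (f ∘ s) x‖ ≤
      m ! * A ^ m * (1 / 4) ^ p * (1 + |x| ^ 2) ^ (l * m + 1) := by
  set w : ℝ := 1 + |x| ^ 2
  have hw : 1 ≤ w := one_le_weight x
  have hD : 1 ≤ A * w ^ l := one_le_mul_of_one_le_of_one_le hA (one_le_pow₀ hw)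
  have key := norm_iteratedDeriv_comp_le hf.1 hs (m := m) (x := x) (C := (1 / 4) ^ p * w) hD
    (fun i hi ↦ ?_) (fun i h1 hi ↦ hsA i h1 hi x) hi
  · calc _ ≤ _ := key
      _ = _ := by rw [mul_pow, ← pow_mul]; ring
  -- Inside `[-B, B]` the point `s x` is off the support of `f`; outside, `w` dominates `1 + B ^ 2`.
  · rcases le_or_gt |x| B with hx | hx
    · rw [hf.iteratedDeriv_eq_zero i (hRB.trans_lt (hesc x hx)), norm_zero]
      positivity
    · have h1 : 1 + B ^ 2 ≤ w := by
        simp only [w]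
        gcongr
      rw [one_div, inv_pow, le_inv_mul_iff₀ (by positivity)]
      exact (hfB i (hi.trans hmp) _).trans h1

section Orbit

variable {d : ℕ → ℝ → 𝕜} {R B : ℕ → ℝ} {t : ℕ → ℕ} {ψ : ℝ → ℝ} (hbij : Function.Bijective ψ)

/-- The terms of index `j ≠ k` in the iterate of order `t k` of the sum of the `d j ∘ ψ_{-t j}`. -/
def offDiagonal (d : ℕ → ℝ → 𝕜) (t : ℕ → ℕ) (k j : ℕ) (x : ℝ) : 𝕜 :=
  if j = k then 0 else d j (iter ψ hbij (t k - t j) x)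

theorem contDiff_offDiagonal (hd : ∀ j, ContDiff ℝ ∞ (d j))
    (hs : ∀ n, ContDiff ℝ ∞ (iter ψ hbij n)) (k j : ℕ) :
    ContDiff ℝ ∞ (offDiagonal hbij d t k j) := by
  unfold offDiagonal
  split_ifs
  · exact contDiff_const
  · exact (hd j).comp (hs _)

/-- As `2^j ≤ 4^(max j k) ≤ 1 + B²` with `B = B (max j k)`, such an `x` lies in `[-B, B]`, which the
iterate moves off the support of `d j`. -/
theorem offDiagonal_eq_zero (hd : ∀ j, IsTestFunction (R j) (d j))
    (hB : ∀ p, 0 ≤ B p ∧ 4 ^ p ≤ 1 + B p ^ 2 ∧ ∀ j ≤ p, R j ≤ B p ∧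
      ∀ i ≤ p, ∀ y, 4 ^ p * ‖iteratedDeriv i (d j) y‖ ≤ 1 + B p ^ 2)
    (ht : ∀ j k, j ≠ k → ∀ x, |x| ≤ B (max j k) → B (max j k) < |iter ψ hbij (t k - t j) x|)
    (k j : ℕ) (x : ℝ) (hx : 1 + |x| ^ 2 < 2 ^ j) : offDiagonal hbij d t k j x = 0 := by
  unfold offDiagonal
  split_ifs with h
  · rfl
  obtain ⟨hB0, hB4, hBR⟩ := hB (max j k)
  refine (hd j).2 _ ((hBR j (le_max_left j k)).1.trans_lt (ht j k h x ?_))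
  by_contra! H
  have h1 : B (max j k) ^ 2 ≤ |x| ^ 2 := by gcongr
  have h2 : (2 : ℝ) ^ j ≤ 4 ^ max j k :=
    (pow_le_pow_left₀ (by norm_num) (by norm_num) j).trans
      (pow_le_pow_right₀ (by norm_num) (le_max_left j k))
  linarith

/-- The escape estimate needs `m ≤ max j k`. The finitely many other pairs get the crude bound `M
j`, which disappears once `k ≥ m`. -/
theorem exists_offDiagonal_bound (hd : ∀ j, IsTestFunction (R j) (d j))
    (hB : ∀ p, 0 ≤ B p ∧ 4 ^ p ≤ 1 + B p ^ 2 ∧ ∀ j ≤ p, R j ≤ B p ∧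
      ∀ i ≤ p, ∀ y, 4 ^ p * ‖iteratedDeriv i (d j) y‖ ≤ 1 + B p ^ 2)
    (ht : ∀ j k, j ≠ k → ∀ x, |x| ≤ B (max j k) → B (max j k) < |iter ψ hbij (t k - t j) x|)
    (hs : ∀ n, ContDiff ℝ ∞ (iter ψ hbij n)) {m l : ℕ} {A : ℝ} (hA : 1 ≤ A)
    (hsA : ∀ n, ∀ i, 1 ≤ i → i ≤ m → ∀ x,
      ‖iteratedDeriv i (iter ψ hbij n) x‖ ≤ A * (1 + |x| ^ 2) ^ l) :
    ∃ M : ℕ → ℝ, ∀ k j, ∀ i ≤ m, ∀ x, ‖iteratedDeriv i (offDiagonal hbij d t k j) x‖ ≤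
      m ! * A ^ m * ((1 / 2) ^ k * (1 / 2) ^ j + if j < m ∧ k < m then M j else 0) *
        (1 + |x| ^ 2) ^ (l * m + 1) := by
  choose M hM using fun j ↦ (hd j).exists_bound m
  have hM0 (j : ℕ) : 0 ≤ M j := (norm_nonneg _).trans (hM j 0 (Nat.zero_le m) 0)
  refine ⟨M, fun k j i hi x ↦ ?_⟩
  have hite : 0 ≤ if j < m ∧ k < m then M j else 0 := by
    split_ifs
    exacts [hM0 j, le_rfl]
  have hw := one_le_weight x
  by_cases hjk : j = k
  · have h0 : offDiagonal hbij d t k j = fun _ ↦ 0 := by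
      funext y
      exact if_pos hjk
    rw [h0, iteratedDeriv_const]
    simp only [ite_self, norm_zero]
    positivity
  have he : offDiagonal hbij d t k j = d j ∘ iter ψ hbij (t k - t j) := by
    funext y
    exact if_neg hjk
  rw [he]
  by_cases hp : j < m ∧ k < m
  · rw [if_pos hp]
    have hD : 1 ≤ A * (1 + |x| ^ 2) ^ l := one_le_mul_of_one_le_of_one_le hA (one_le_pow₀ hw)
    have key := norm_iteratedDeriv_comp_le (hd j).1 (hs (t k - t j)) hD
      (fun i hi ↦ hM j i hi _) (fun i h1 hi ↦ hsA _ i h1 hi x) hi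
    calc _ ≤ _ := key
      _ = m ! * A ^ m * M j * (1 + |x| ^ 2) ^ (l * m) := by rw [mul_pow, ← pow_mul]; ring
      _ ≤ _ := by
        gcongr
        · have := hM0 j; positivity
        · exact le_add_of_nonneg_left (by positivity)
        · omega
  · obtain ⟨hB0, -, hBR⟩ := hB (max j k)
    obtain ⟨hR, hdB⟩ := hBR j (le_max_left j k)
    refine (norm_iteratedDeriv_comp_le_of_escape (hd j) (hs _) hA (hsA _) hB0 hR (by omega) hdB
      (ht j k hjk) hi x).trans ?_
    rw [if_neg hp, add_zero]
    gcongr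
    exact quarter_pow_max_le j k

end Orbit

/-- Order zero is excluded because only the `(ψ_n)'` are bounded; the chain rule needs no more of
the inner function. -/
theorem exists_iter_bound {ψ : ℝ → ℝ} (hbij : Function.Bijective ψ)
    (hmem : ∀ n : ℤ, deriv (iter ψ hbij n) ∈ omSubmodule ℝ)
    (hbdd : Bornology.IsVonNBounded ℝ (range fun n : ℤ ↦ toOM (deriv (iter ψ hbij n)) (hmem n)))
    (m : ℕ) : ∃ (l : ℕ) (A : ℝ), 1 ≤ A ∧ ∀ n, ∀ i, 1 ≤ i → i ≤ m → ∀ x,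
      ‖iteratedDeriv i (iter ψ hbij n) x‖ ≤ A * (1 + |x| ^ 2) ^ l := by
  obtain ⟨l, A, hA⟩ := exists_bound_of_isVonNBounded hbdd m
  refine ⟨l, max A 1, le_max_right _ _, fun n i h1 hi x ↦ ?_⟩
  obtain ⟨i, rfl⟩ := Nat.exists_eq_add_of_le' h1
  rw [iteratedDeriv_succ']
  refine (hA n i (by omega) x).trans ?_
  gcongr
  exact le_max_left _ _

theorem summable_offDiagonal_bound (c q : ℝ) (m k : ℕ) (M : ℕ → ℝ) :
    Summable fun j : ℕ ↦ c * (q * (1 / 2) ^ j + if j < m ∧ k < m then M j else 0) := by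
  refine Summable.mul_left _ ((summable_geometric_two.mul_left _).add ?_)
  refine summable_of_ne_finset_zero (s := Finset.range m) fun j hj ↦ if_neg fun h ↦ ?_
  exact hj (Finset.mem_range.2 h.1)

end SlowGrowth

end

/-! ### The sequentially hypercyclic vector -/

open SlowGrowth in
theorem corollary2p3 {𝕜 : Type*} [RCLike 𝕜] (ψ : ℝ → ℝ)
    (hψ : ψ ∈ SlowGrowth.omSubmodule ℝ)
    (hbij : Function.Bijective ψ)
    (hfix : ∀ x, ψ x ≠ x)
    (hderiv : ∀ x, 0 < deriv ψ x)
    (hmem : ∀ n : ℤ, deriv (SlowGrowth.iter ψ hbij n) ∈ SlowGrowth.omSubmodule ℝ)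
    (hbdd : Bornology.IsVonNBounded ℝ
      (Set.range fun n : ℤ ↦ SlowGrowth.toOM (deriv (SlowGrowth.iter ψ hbij n)) (hmem n))) :
    SlowGrowth.IsSequentiallyHypercyclic (SlowGrowth.compositionOperator 𝕜 ψ hψ) := by
  have hψs : ContDiff ℝ ∞ ψ := (mem_omSubmodule_iff.1 hψ).1
  have hs := contDiff_iter hbij hψs hderiv
  obtain ⟨d, hdR, hdense⟩ := exists_sequentially_dense_testFunctions 𝕜
  choose R hd using hdR
  obtain ⟨B, hB⟩ := exists_dominating_radii hd
  obtain ⟨t, ht0, ht⟩ := exists_separating_times hbij hψs.continuous hfix B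
  have hz (k : ℕ) := offDiagonal_eq_zero hbij hd hB ht k
  have hu (k : ℕ) := contDiff_offDiagonal hbij (t := t) (fun j ↦ (hd j).1) hs k
  let S : ℕ → ℝ → 𝕜 := fun k x ↦ ∑' j, offDiagonal hbij d t k j x
  have hS (k : ℕ) : ContDiff ℝ ∞ (S k) := contDiff_tsum_of_vanish (hz k) (hu k)
  -- The exponent, `c` and `M` are uniform in `k`: large `k` gives `S k → 0`, and `k = 0` gives the
  -- membership of `G`.
  have hSb (m : ℕ) : ∃ (n : ℕ) (c : ℝ) (M : ℕ → ℝ), ∀ k, ∀ i ≤ m, ∀ x,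
      ‖iteratedDeriv i (S k) x‖ ≤
        (∑' j : ℕ, c * ((1 / 2) ^ k * (1 / 2) ^ j + if j < m ∧ k < m then M j else 0)) *
          (1 + |x| ^ 2) ^ n := by
    obtain ⟨l, A, hA, hsA⟩ := exists_iter_bound hbij hmem hbdd m
    obtain ⟨M, hM⟩ := exists_offDiagonal_bound hbij hd hB ht hs hA hsA
    exact ⟨l * m + 1, m ! * A ^ m, M, fun k i hi x ↦ norm_iteratedDeriv_tsum_le (hz k) (hu k)
      (summable_offDiagonal_bound _ _ _ _ _) (by positivity) fun j ↦ hM k j i hi x⟩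
  have hSnull : IsWeightedNull S := by
    intro m
    obtain ⟨n, c, M, h⟩ := hSb m
    refine ⟨n, fun k ↦ c * 2 * (1 / 2) ^ k, ?_, ?_⟩
    · simpa using (tendsto_pow_atTop_nhds_zero_of_lt_one (r := (1 / 2 : ℝ)) (by norm_num)
        (by norm_num)).const_mul (c * 2)
    · filter_upwards [eventually_ge_atTop m] with k hk
      refine ⟨contDiff_infty.1 (hS k) m, fun i hi x ↦ (h k i hi x).trans_eq ?_⟩
      simp only [not_lt.2 hk, and_false, if_false, add_zero]
      rw [tsum_mul_left, tsum_mul_left, tsum_geometric_two]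
      ring
  let G : ℝ → 𝕜 := fun x ↦ ∑' j, d j (iter ψ hbij (-t j) x)
  have hG (k : ℕ) : G ∘ ψ^[t k] = d k + S k := by
    funext x
    have h1 (j : ℕ) : d j (iter ψ hbij (-t j) (ψ^[t k] x)) = d j (iter ψ hbij (t k - t j) x) := by
      rw [← iter_natCast hbij, ← iter_add, neg_add_eq_sub]
    have h2 : Summable fun j ↦ d j (iter ψ hbij (t k - t j) x) := by
      obtain ⟨J, hJ⟩ := pow_unbounded_of_one_lt (1 + |x| ^ 2) (one_lt_two (α := ℝ))
      refine summable_of_ne_finset_zero (s := Finset.range (J + k + 1)) fun j hj ↦ ?_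
      rw [Finset.mem_range, not_lt] at hj
      have h3 := hz k j x (hJ.trans_le (pow_le_pow_right₀ one_le_two (by omega)))
      rwa [offDiagonal, if_neg (by omega)] at h3
    change ∑' j, d j (iter ψ hbij (-t j) (ψ^[t k] x)) = _
    simp_rw [h1]
    rw [h2.tsum_eq_add_tsum_ite k, sub_self, iter_zero]
    rfl
  have hGmem : G ∈ omSubmodule 𝕜 := by
    -- Because `t 0 = 0`, the decomposition of the orbit at `k = 0` is that of `G` itself.
    have h0 : G = d 0 + S 0 := by
      rw [← hG 0, ht0]
      rfl
    rw [h0, mem_omSubmodule_iff]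
    refine ⟨(hd 0).1.add (hS 0), fun m ↦ ?_⟩
    obtain ⟨n, q, h⟩ : ∃ (n : ℕ) (q : ℝ), ∀ i ≤ m, ∀ x,
        ‖iteratedDeriv i (S 0) x‖ ≤ q * (1 + |x| ^ 2) ^ n := by
      obtain ⟨n, c, M, h⟩ := hSb m
      exact ⟨n, _, h 0⟩
    obtain ⟨C, hC⟩ := (hd 0).exists_bound m
    have hC0 : 0 ≤ C := (norm_nonneg _).trans (hC 0 (Nat.zero_le m) 0)
    refine ⟨n, C + q, fun j hj x ↦ ?_⟩
    rw [iteratedDeriv_add (contDiff_infty.1 (hd 0).1 j).contDiffAt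
      (contDiff_infty.1 (hS 0) j).contDiffAt, add_mul]
    exact (norm_add_le _ _).trans (add_le_add ((hC j hj x).trans
      (le_mul_of_one_le_right hC0 (one_le_pow₀ (one_le_weight x)))) (h j hj x))
  refine ⟨toOM G hGmem, eq_univ_of_forall fun f ↦ ?_⟩
  obtain ⟨k, hk, hnull⟩ := hdense f.1 f.2
  refine ⟨fun i ↦ (compositionOperator 𝕜 ψ hψ)^[t (k i)] (toOM G hGmem),
    fun i ↦ ⟨t (k i), rfl⟩, tendsto_of_isWeightedNull ?_⟩
  convert hnull.add (hSnull.comp_tendsto hk) using 2 with i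
  rw [compositionOperator_iterate]
  change G ∘ ψ^[t (k i)] - f.1 = _
  rw [hG]
  abel
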